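/- Let $(W,S)$ be a Coxeter system with $S$ finite, $n=|S|$, and Coxeter matrix $(m_{st})$. For each pair with $m_{st}=\infty$ choose a real number $c_{st}=c_{ts}\ge 1$. Let $V=\mathbb R^S$ with basis of simple roots $\Delta=\{\alpha_s\}_{s\in S}$, and let $\mathcal B$ be the symmetric bilinear form on $V$ with $\mathcal B(\alpha_s,\alpha_t)=-\cos(\pi/m_{st})$ if $m_{st}<\infty$ and $\mathcal B(\alpha_s,\alpha_t)=-c_{st}$ if $m_{st}=\infty$. Let $W$ act on $V$ through the geometric representation, in which $s\in S$ acts by the reflection $\mathbf x\mapsto \mathbf x-2\mathcal B(\mathbf x,\alpha_s)\alpha_s$, and hence on the projective space $\mathbb PV$. Assume that the system is Lorentzian, i.e. that $\mathcal B$ has signature $(n-1,1)$. Write $\widehat{\mathbf x}\in\mathbb PV$ for the line spanned by $\mathbf x\ne 0$, and let $\widehat Q=\{\widehat{\mathbf x}\mid \mathbf x\neq 0,\ \mathcal B(\mathbf x,\mathbf x)=0\}$ be the projective light cone; its points are called light-like. Given a sequence $(w_k)_{k\in\mathbb N}$ in $W$ and points $x_0,x\in\mathbb PV$, we say that $x$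 is a limit direction arising from the base point $x_0$ through $(w_k)$ if the sequence $(w_k\cdot x_0)_{k\in\mathbb N}$ is injective and converges to $x$. Let $\Phi=W(\Delta)$ be the set of roots. A point $x\in\mathbb PV$ is a limit root if there is an injective sequence $(\gamma_k)_{k\in\mathbb N}$ in $\Phi$ with $\widehat{\gamma_k}\to x$. Then: 1. Every limit direction $x\in\widehat Q$, arising from any base point $x_0\in\mathbb PV$ through any sequence in $W$, is a limit root. 2. In particular, every limit direction arising from a light-like base point $x_0\in\widehat Q$ is a limit root. 3. For every sequence $(w_k)_{k\in\mathbb N}$ in $W$ there is a point $p\in\widehat Q$ such that all limit directions in $\widehat Q$ that arise through $(w_k)$ from base points different from $p$ coincide. In particular, all limit directions in $\widehat Q$ that arise through $(w_k)$ from base points outside $\widehat Q$ coincide. -/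

import Mathlib

open Filter Topology
open scoped LinearAlgebra.Projectivization

/-- The real projective space of a topological vector space carries the quotient topology of
`V \ {0}`. -/
noncomputable instance Projectivization.instTopologicalSpaceReal {V : Type*} [AddCommGroup V] [Module ℝ V]
    [TopologicalSpace V] : TopologicalSpace (ℙ ℝ V) :=
  TopologicalSpace.coinduced (Projectivization.mk' ℝ : {v : V // v ≠ 0} → ℙ ℝ V) inferInstance

/-- A geometric Coxeter system `(W, S)_B`: a Coxeter system together with a choice of weights
`c s t = c t s ≥ 1` for the pairs with `m s t = ∞`. Mathlib encodes `m s t = ∞` as `M s t = 0`;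
the values of `c` at the other pairs play no role. -/
structure GeometricCoxeterSystem (S W : Type*) [Group W] where
  /-- the Coxeter matrix -/
  M : CoxeterMatrix S
  /-- the Coxeter system -/
  cs : CoxeterSystem M W
  /-- the weights of the pairs with `m s t = ∞` -/
  c : S → S → ℝ
  c_symm : ∀ s t, M s t = 0 → c s t = c t s
  one_le_c : ∀ s t, M s t = 0 → 1 ≤ c s t

namespace GeometricCoxeterSystem

noncomputable section

variable {S W : Type*} [Group W] (G : GeometricCoxeterSystem S W)

/-- The matrix `B`. -/
def matrixB : Matrix S S ℝ :=
  Matrix.of fun s t => if G.M s t = 0 then -G.c s t else -Real.cos (Real.pi / G.M s t)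

theorem matrixB_self (s : S) : G.matrixB s s = 1 := by
  simp [matrixB]

variable [Fintype S] [DecidableEq S]

/-- The bilinear form on `V = ℝ^S` given by `B`. -/
def form : LinearMap.BilinForm ℝ (S → ℝ) := Matrix.toBilin' G.matrixB

/-- The system is Lorentzian if `B` has signature `(n - 1, 1)`, where `n = |S|`. -/
def IsLorentzian : Prop :=
  sigPos (LinearMap.BilinMap.toQuadraticMap G.form) + 1 = Fintype.card S ∧
    sigNeg (LinearMap.BilinMap.toQuadraticMap G.form) = 1

/-- The simple root `α_s`, a standard basis vector of `V = ℝ^S`. -/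
def simpleRoot (_G : GeometricCoxeterSystem S W) (s : S) : S → ℝ := Pi.single s 1

theorem form_simpleRoot (s t : S) :
    G.form (G.simpleRoot s) (G.simpleRoot t) = G.matrixB s t := by
  simp [form, simpleRoot]

/-- The reflection `x ↦ x - 2 (B(x, α) / B(α, α)) α` in a vector `α` with `B(α, α) ≠ 0`. -/
def reflection (α : S → ℝ) (h : G.form α α ≠ 0) : (S → ℝ) ≃ₗ[ℝ] (S → ℝ) :=
  Module.reflection (x := α) (f := (2 / G.form α α) • G.form.flip α) (by simp [h])

theorem reflection_apply (α : S → ℝ) (h : G.form α α ≠ 0) (x : S → ℝ) :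
    G.reflection α h x = x - (2 * (G.form x α / G.form α α)) • α := by
  rw [reflection, Module.reflection_apply]
  congr 2
  simp
  ring

theorem form_simpleRoot_self_ne_zero (s : S) :
    G.form (G.simpleRoot s) (G.simpleRoot s) ≠ 0 := by
  rw [form_simpleRoot, matrixB_self]
  exact one_ne_zero

/-- The reflection `σ_s` in the simple root `α_s`. -/
def simpleReflection (s : S) : (S → ℝ) ≃ₗ[ℝ] (S → ℝ) :=
  G.reflection (G.simpleRoot s) (G.form_simpleRoot_self_ne_zero s)

/-- The reflections in the simple roots satisfy the Coxeter relations. -/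
theorem isLiftable_simpleReflection : G.M.IsLiftable G.simpleReflection := by
  intro s t
  by_cases h0 : G.M s t = 0
  · simp [h0]
  have hst : G.form (G.simpleRoot s) (G.simpleRoot t) = -Real.cos (Real.pi / G.M s t) := by
    rw [form_simpleRoot]; simp [matrixB, h0]
  have hts : G.form (G.simpleRoot t) (G.simpleRoot s) = -Real.cos (Real.pi / G.M s t) := by
    rw [form_simpleRoot]; simp [matrixB, G.M.symmetric t s, h0]
  have hself : ∀ u, G.form (G.simpleRoot u) (G.simpleRoot u) = 1 := fun u => by
    rw [form_simpleRoot, matrixB_self]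
  obtain h1 | h2 | h3 : G.M s t = 1 ∨ G.M s t = 2 ∨ 3 ≤ G.M s t := by omega
  · have : s = t := by
      by_contra hne
      exact G.M.off_diagonal s t hne h1
    subst this
    rw [h1, pow_one]
    apply LinearEquiv.ext
    intro x
    exact Module.involutive_reflection (by simp [hself]) x
  · rw [h2] at hst hts ⊢
    have hc : Real.cos (Real.pi / (2 : ℕ)) = 0 := by
      push_cast; exact Real.cos_pi_div_two
    rw [hc, neg_zero] at hst hts
    apply LinearEquiv.ext
    intro x
    simp only [pow_two, LinearEquiv.mul_apply, simpleReflection, reflection_apply, map_sub,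
      map_smul, hst, hts, hself,
      LinearEquiv.coe_one, id]
    simp
    module
  · generalize hm : G.M s t = m at *
    have hmR : (3 : ℝ) ≤ m := by exact_mod_cast h3
    have hθ : 0 < Real.sin (2 * (Real.pi / m)) := by
      apply Real.sin_pos_of_pos_of_lt_pi
      · have := Real.pi_pos
        positivity
      · rw [← mul_div_assoc, div_lt_iff₀ (by linarith)]
        nlinarith [Real.pi_pos]
    set θ := 2 * (Real.pi / m) with hθdef
    have hmθ : (m : ℝ) * θ = 2 * Real.pi := by
      rw [hθdef]; field_simp
    have hS : ∀ k : ℤ, (Polynomial.Chebyshev.S ℝ k).eval (2 * Real.cos θ)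
        = Real.sin ((k + 1) * θ) / Real.sin θ := fun k => by
      rw [eq_div_iff hθ.ne', Polynomial.Chebyshev.S_two_mul_real_cos]
    apply LinearEquiv.ext
    intro x
    rw [simpleReflection, simpleReflection, reflection, reflection,
      Module.reflection_mul_reflection_pow_apply _ _ m x (2 * Real.cos θ) (by
        simp [hself, hst, hts, hθdef, Real.cos_two_mul]; ring)]
    have key : (Polynomial.Chebyshev.S ℝ (((m : ℤ) - 2) / 2)).eval (2 * Real.cos θ) *
          ((Polynomial.Chebyshev.S ℝ (((m : ℤ) - 1) / 2)).eval (2 * Real.cos θ) +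
          (Polynomial.Chebyshev.S ℝ (((m : ℤ) - 3) / 2)).eval (2 * Real.cos θ)) = 0 ∧
        (Polynomial.Chebyshev.S ℝ (((m : ℤ) - 1) / 2)).eval (2 * Real.cos θ) *
          ((Polynomial.Chebyshev.S ℝ ((m : ℤ) / 2)).eval (2 * Real.cos θ) +
          (Polynomial.Chebyshev.S ℝ (((m : ℤ) - 2) / 2)).eval (2 * Real.cos θ)) = 0 := by
      obtain ⟨k, hk | hk⟩ := Nat.even_or_odd' m
      · have e1 : ((m : ℤ) - 2) / 2 = k - 1 := by omega
        have e2 : ((m : ℤ) - 1) / 2 = k - 1 := by omega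
        have z : (Polynomial.Chebyshev.S ℝ ((k : ℤ) - 1)).eval (2 * Real.cos θ) = 0 := by
          rw [hS]
          have : (((k : ℤ) - 1 : ℤ) + 1 : ℝ) * θ = Real.pi := by
            rw [hk] at hmθ
            push_cast at hmθ ⊢
            linarith
          rw [this, Real.sin_pi, zero_div]
        rw [e1, e2, z]
        simp
      · have e1 : ((m : ℤ) - 2) / 2 = k - 1 := by omega
        have e2 : ((m : ℤ) - 1) / 2 = k := by omega
        have e3 : ((m : ℤ) - 3) / 2 = k - 1 := by omega
        have e4 : (m : ℤ) / 2 = k := by omega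
        have z : (Polynomial.Chebyshev.S ℝ (k : ℤ)).eval (2 * Real.cos θ) +
            (Polynomial.Chebyshev.S ℝ ((k : ℤ) - 1)).eval (2 * Real.cos θ) = 0 := by
          rw [hS, hS]
          have : (((k : ℤ) : ℝ) + 1) * θ = 2 * Real.pi - (((k : ℤ) - 1 : ℤ) + 1 : ℝ) * θ := by
            rw [hk] at hmθ
            push_cast at hmθ ⊢
            linarith
          rw [this, Real.sin_two_pi_sub]
          ring
        rw [e1, e2, e3, e4, z]
        simp
    rw [key.1, key.2]
    simp

/-- The geometric representation `ρ : W → GL(V)`, the homomorphism sending each generator `s` to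
the reflection in `α_s`. -/
def rep : W →* ((S → ℝ) ≃ₗ[ℝ] (S → ℝ)) :=
  G.cs.lift ⟨G.simpleReflection, G.isLiftable_simpleReflection⟩

theorem rep_simple (s : S) : G.rep (G.cs.simple s) = G.simpleReflection s :=
  G.cs.lift_apply_simple G.isLiftable_simpleReflection s

/-- The set `Φ = W(Δ)` of roots. -/
def roots : Set (S → ℝ) := {γ | ∃ (w : W) (s : S), γ = G.rep w (G.simpleRoot s)}

theorem ne_zero_of_mem_roots {γ : S → ℝ} (h : γ ∈ G.roots) : γ ≠ 0 := by
  obtain ⟨w, s, rfl⟩ := h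
  simp [simpleRoot]

/-- The set `E_Φ` of limit roots: limits in `ℙV` of the directions of injective sequences of
roots. -/
def limitRoots : Set (ℙ ℝ (S → ℝ)) :=
  {x | ∃ (γ : ℕ → S → ℝ) (hγ : ∀ k, γ k ∈ G.roots), Function.Injective γ ∧
    Tendsto (fun k => Projectivization.mk ℝ (γ k) (G.ne_zero_of_mem_roots (hγ k))) atTop (𝓝 x)}

/-- The projective light cone. -/
def projLightCone : Set (ℙ ℝ (S → ℝ)) :=
  {x | ∃ (v : S → ℝ) (hv : v ≠ 0), G.form v v = 0 ∧ x = Projectivization.mk ℝ v hv}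

/-- The point `x` of `ℙV` is a limit direction arising from the base point `x₀` through the
sequence `w`: the sequence of points `w k · x₀` is injective and converges to `x`. -/
def ArisesThrough (w : ℕ → W) (x₀ x : ℙ ℝ (S → ℝ)) : Prop :=
  Function.Injective (fun k => G.rep (w k) • x₀) ∧
    Tendsto (fun k => G.rep (w k) • x₀) atTop (𝓝 x)

end

end GeometricCoxeterSystem

namespace GeometricCoxeterSystem

variable {S W : Type*} [Group W] (G : GeometricCoxeterSystem S W)

/-! An infinite set of elements of `W` degenerates to a rank-one map. Roots are positive or negative
(`rep_simpleRoot_nonneg`), so a nontrivial `w` stays away from the identity; hence only finitely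
many elements have bounded norm (`finite_norm_rep_le`). Rescaling injective `w k` by their norms `N
k → ∞`, a subsequence tends to a nonzero map with totally isotropic image, since `B (w x) (w y) / N
^ 2 → 0`. In Lorentzian signature such an image is a line, so the limit is `v ↦ B(q, v) u`; as `w⁻¹`
is adjoint to `w`, the inverses tend to `v ↦ B(u, v) q`, and `u`, `q` are isotropic
(`exists_subseq_tendsto`).

From a base point other than `q`, a light-like limit must be `u` (`eq_mk_of_arisesThrough`), which
gives the third claim with `p = q`. Moreover `u` is a limit root, because `w k` pushes any simple
root not orthogonal to `q` towards `u`. If the base point is `q`, approximate it by directions of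
roots `w⁻¹ α_s` and take a diagonal sequence. -/

theorem matrixB_symm (s t : S) : G.matrixB s t = G.matrixB t s := by
  simp only [matrixB, Matrix.of_apply, G.M.symmetric s t]
  split_ifs with h
  · rw [G.c_symm t s h]
  · rfl

/-! ### Dihedral subsystems and positivity of roots -/

/-- The coefficients of the roots of a dihedral subsystem satisfy a two-term recurrence, and are
nonnegative up to the order of the dihedral group. -/
theorem exists_dihedral_coeff {s t : S} (hst : s ≠ t) :
    ∃ a : ℕ → ℝ, a 0 = 0 ∧ a 1 = 1 ∧
      (∀ k, a (k + 2) = -2 * G.matrixB s t * a (k + 1) - a k) ∧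
      ∀ k, (G.M s t ≠ 0 → k ≤ G.M s t) → 0 ≤ a k := by
  by_cases h0 : G.M s t = 0
  · have hc := G.one_le_c s t h0
    have hB : G.matrixB s t = -G.c s t := by simp [matrixB, h0]
    -- `-2B = 2c` turns the recurrence into that of `U`; the shift gives `U_{-1} = 0` and `U_0 = 1`
    -- as initial values.
    refine ⟨fun k => (Polynomial.Chebyshev.U ℝ ((k : ℤ) - 1)).eval (G.c s t), ?_, ?_, ?_, ?_⟩
    · simp
    · simp
    · intro k
      have := Polynomial.Chebyshev.U_add_two ℝ ((k : ℤ) - 1)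
      have e1 : ((k + 2 : ℕ) : ℤ) - 1 = (k : ℤ) - 1 + 2 := by push_cast; ring
      have e2 : ((k + 1 : ℕ) : ℤ) - 1 = (k : ℤ) - 1 + 1 := by push_cast; ring
      simp only [e1, e2, this, hB]
      simp
    · intro k _
      -- Nonnegativity alone does not propagate; joint with monotonicity it does, since `2c - 1 ≥
      -- 1`.
      suffices h : 0 ≤ (Polynomial.Chebyshev.U ℝ ((k : ℤ) - 1)).eval (G.c s t) ∧
          (Polynomial.Chebyshev.U ℝ ((k : ℤ) - 1)).eval (G.c s t) ≤
            (Polynomial.Chebyshev.U ℝ (k : ℤ)).eval (G.c s t) from h.1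
      clear * - hc
      induction k with
      | zero => simp
      | succ k ih =>
        have h2 := congrArg (Polynomial.eval (G.c s t))
          (Polynomial.Chebyshev.U_add_two ℝ ((k : ℤ) - 1))
        have e1 : (k : ℤ) - 1 + 2 = ((k + 1 : ℕ) : ℤ) := by push_cast; ring
        have e2 : (k : ℤ) - 1 + 1 = k := by ring
        have e3 : ((k + 1 : ℕ) : ℤ) - 1 = k := by push_cast; ring
        rw [e1, e2] at h2
        simp only [Polynomial.eval_sub, Polynomial.eval_mul, Polynomial.eval_ofNat,
          Polynomial.eval_X] at h2
        rw [e3, h2]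
        constructor
        · linarith
        · nlinarith
  · have hB : G.matrixB s t = -Real.cos (Real.pi / G.M s t) := by simp [matrixB, h0]
    have h1 : G.M s t ≠ 1 := G.M.off_diagonal s t hst
    have hm : (2 : ℝ) ≤ G.M s t := by exact_mod_cast (by omega : 2 ≤ G.M s t)
    have hθ : 0 < Real.sin (Real.pi / G.M s t) := by
      apply Real.sin_pos_of_pos_of_lt_pi
      · have := Real.pi_pos
        positivity
      · rw [div_lt_iff₀ (by linarith)]
        nlinarith [Real.pi_pos]
    refine ⟨fun k => Real.sin (k * (Real.pi / G.M s t)) / Real.sin (Real.pi / G.M s t),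
      by simp, by simp [hθ.ne'], ?_, ?_⟩
    · intro k
      rw [hB]
      generalize Real.pi / G.M s t = θ at *
      have e1 : ((k + 2 : ℕ) : ℝ) * θ = (k + 1 : ℕ) * θ + θ := by push_cast; ring
      have e2 : (k : ℝ) * θ = (k + 1 : ℕ) * θ - θ := by push_cast; ring
      simp only [e1, e2, Real.sin_add, Real.sin_sub]
      ring
    · intro k hk
      have hk' : (k : ℝ) ≤ G.M s t := by exact_mod_cast hk h0
      refine div_nonneg (Real.sin_nonneg_of_nonneg_of_le_pi ?_ ?_) hθ.le
      · have := Real.pi_pos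
        positivity
      · rw [← mul_div_assoc, div_le_iff₀ (by linarith)]
        nlinarith [Real.pi_pos]

variable [Fintype S] [DecidableEq S]

theorem form_simpleRoot_self (s : S) : G.form (G.simpleRoot s) (G.simpleRoot s) = 1 := by
  rw [form_simpleRoot, matrixB_self]

theorem simpleReflection_apply (s : S) (x : S → ℝ) :
    G.simpleReflection s x = x - (2 * G.form x (G.simpleRoot s)) • G.simpleRoot s := by
  rw [simpleReflection, reflection_apply, form_simpleRoot_self, div_one]

theorem simpleReflection_simpleRoot_self (s : S) :
    G.simpleReflection s (G.simpleRoot s) = -G.simpleRoot s := by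
  rw [simpleReflection_apply, form_simpleRoot_self]
  module

theorem rep_mul_apply (v w : W) (x : S → ℝ) : G.rep (v * w) x = G.rep v (G.rep w x) := by
  rw [map_mul, LinearEquiv.mul_apply]

/-- Each new leftmost letter changes only its own coefficient, and the change is exactly one step of
the recurrence. -/
theorem rep_alternatingWord_simpleRoot {s t : S} {a : ℕ → ℝ} (h0 : a 0 = 0) (h1 : a 1 = 1)
    (ha : ∀ k, a (k + 2) = -2 * G.matrixB s t * a (k + 1) - a k) (k : ℕ) :
    G.rep (G.cs.wordProd (CoxeterSystem.alternatingWord s t k)) (G.simpleRoot s) =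
      if Even k then a (k + 1) • G.simpleRoot s + a k • G.simpleRoot t
      else a k • G.simpleRoot s + a (k + 1) • G.simpleRoot t := by
  induction k with
  | zero => simp [CoxeterSystem.alternatingWord, h0, h1]
  | succ k ih =>
    rw [CoxeterSystem.alternatingWord_succ', CoxeterSystem.wordProd_cons, rep_mul_apply, ih,
      rep_simple, ha]
    by_cases hk : Even k
    · have hk' : ¬ Even (k + 1) := by simpa [Nat.even_add_one] using hk
      simp only [hk, hk', if_true, if_false, map_add, map_smul, simpleReflection_apply,
        form_simpleRoot, matrixB_self]
      module
    · have hk' : Even (k + 1) := by simpa [Nat.even_add_one] using hk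
      simp only [hk, hk', if_true, if_false, map_add, map_smul, simpleReflection_apply,
        form_simpleRoot, matrixB_self, G.matrixB_symm t s]
      module

/-- If `ℓ(ws) > ℓ(w)` then `w α_s` is a nonnegative combination of simple roots. -/
theorem rep_simpleRoot_nonneg (w : W) (s : S)
    (h : G.cs.length w < G.cs.length (w * G.cs.simple s)) : 0 ≤ G.rep w (G.simpleRoot s) := by
  induction hn : G.cs.length w using Nat.strong_induction_on generalizing w s with
  | _ n ih =>
  subst hn
  have hα : ∀ u, 0 ≤ G.simpleRoot u := fun u => by simp [simpleRoot]
  by_cases hw : w = 1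
  · subst hw
    simpa using hα s
  obtain ⟨t, ht⟩ := G.cs.exists_rightDescent_of_ne_one hw
  have hst : s ≠ t := by
    rintro rfl
    exact absurd ht (not_lt.2 h.le)
  -- Split off the longest alternating suffix with additive lengths; the remaining factor `v` then
  -- has neither `s` nor `t` as a right descent, so induction applies to both `v α_s` and `v α_t`.
  let P : ℕ → Prop := fun k => ∃ v, w = v * G.cs.wordProd (CoxeterSystem.alternatingWord s t k) ∧
    G.cs.length w = G.cs.length v + k
  have hP1 : P 1 := by
    refine ⟨w * G.cs.simple t, ?_, ?_⟩
    · simp [CoxeterSystem.alternatingWord]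
    · exact (G.cs.isRightDescent_iff.1 ht).symm
  have hbdd : ∀ k, P k → k ≤ G.cs.length w := fun k ⟨v, _, hv⟩ => by omega
  obtain ⟨k, ⟨v, hwv, hlv⟩, hkmax⟩ : ∃ k, P k ∧ ¬ P (k + 1) := by
    by_contra! hcon
    have : ∀ k, P (k + 1) := fun k => Nat.rec hP1 (fun k hk => hcon _ hk) k
    have := hbdd _ (this (G.cs.length w))
    omega
  have hk0 : k ≠ 0 := by
    rintro rfl
    exact hkmax hP1
  have hnext : G.cs.length v < G.cs.length (v * G.cs.simple (if Even k then t else s)) := by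
    by_contra hcon
    have hd := (G.cs.isRightDescent_iff (w := v) (i := if Even k then t else s)).1
      (lt_of_le_of_ne (not_lt.1 hcon) (G.cs.length_mul_simple_ne _ _))
    refine hkmax ⟨v * G.cs.simple (if Even k then t else s), ?_, by omega⟩
    rw [CoxeterSystem.alternatingWord_succ', CoxeterSystem.wordProd_cons, mul_assoc,
      CoxeterSystem.simple_mul_simple_cancel_left, ← hwv]
  have hfirst : G.cs.length v < G.cs.length (v * G.cs.simple (if Even k then s else t)) := by
    by_contra hcon
    have hd := (G.cs.isRightDescent_iff (w := v) (i := if Even k then s else t)).1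
      (lt_of_le_of_ne (not_lt.1 hcon) (G.cs.length_mul_simple_ne _ _))
    obtain ⟨j, rfl⟩ := Nat.exists_eq_succ_of_ne_zero hk0
    have e : (if Even (j + 1) then s else t) = if Even j then t else s := by
      simp only [Nat.even_add_one]
      split_ifs <;> rfl
    have e2 : w = (v * G.cs.simple (if Even (j + 1) then s else t)) *
        G.cs.wordProd (CoxeterSystem.alternatingWord s t j) := by
      rw [e, hwv, Nat.succ_eq_add_one, CoxeterSystem.alternatingWord_succ',
        CoxeterSystem.wordProd_cons, mul_assoc]
    have l1 := G.cs.length_mul_le (v * G.cs.simple (if Even (j + 1) then s else t))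
      (G.cs.wordProd (CoxeterSystem.alternatingWord s t j))
    rw [← e2] at l1
    have l2 := G.cs.length_wordProd_le (CoxeterSystem.alternatingWord s t j)
    rw [CoxeterSystem.length_alternatingWord] at l2
    simp only [Nat.succ_eq_add_one] at hd
    omega
  have hvs : 0 ≤ G.rep v (G.simpleRoot s) := by
    apply ih _ (by omega) v s _ rfl
    split_ifs at hnext hfirst <;> assumption
  have hvt : 0 ≤ G.rep v (G.simpleRoot t) := by
    apply ih _ (by omega) v t _ rfl
    split_ifs at hnext hfirst <;> assumption
  -- The coefficient `a (k + 1)` occurs, so `k + 1` must be bounded. As `ℓ(ws) > ℓ(w)`, the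
  -- alternating word of length `k + 1` ending in `s` is reduced.
  have hkM : G.M s t ≠ 0 → k + 1 ≤ G.M s t := by
    intro h0
    by_contra hcon
    rw [G.M.symmetric s t] at h0 hcon
    apply G.cs.not_isReduced_alternatingWord t s h0 (not_le.1 hcon)
    have e3 : w * G.cs.simple s =
        v * G.cs.wordProd (CoxeterSystem.alternatingWord t s (k + 1)) := by
      rw [CoxeterSystem.alternatingWord_succ, CoxeterSystem.wordProd_concat, ← mul_assoc, ← hwv]
    have l1 := G.cs.length_mul_le v (G.cs.wordProd (CoxeterSystem.alternatingWord t s (k + 1)))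
    rw [← e3] at l1
    have l2 := G.cs.length_wordProd_le (CoxeterSystem.alternatingWord t s (k + 1))
    rw [CoxeterSystem.length_alternatingWord] at l2
    rw [CoxeterSystem.IsReduced, CoxeterSystem.length_alternatingWord]
    omega
  obtain ⟨a, a0, a1, ha, hapos⟩ := G.exists_dihedral_coeff hst
  have p1 : 0 ≤ a (k + 1) := hapos _ hkM
  have p0 : 0 ≤ a k := hapos _ fun h0 => (Nat.le_succ k).trans (hkM h0)
  rw [hwv, rep_mul_apply, G.rep_alternatingWord_simpleRoot a0 a1 ha]
  split_ifs <;> simp only [map_add, map_smul] <;>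
    exact add_nonneg (smul_nonneg (by assumption) (by assumption))
      (smul_nonneg (by assumption) (by assumption))

/-- An element of `W` that nearly fixes every simple root is trivial. -/
theorem eq_one_of_rep_simpleRoot_pos (w : W) (h : ∀ s, 0 < G.rep w (G.simpleRoot s) s) :
    w = 1 := by
  by_contra hw
  obtain ⟨s, hs⟩ := G.cs.exists_rightDescent_of_ne_one hw
  have := G.rep_simpleRoot_nonneg (w * G.cs.simple s) s (by
    rw [CoxeterSystem.simple_mul_simple_cancel_right]
    exact hs)
  rw [rep_mul_apply, rep_simple, simpleReflection_simpleRoot_self, map_neg] at this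
  have h1 := this s
  simp only [Pi.zero_apply, Pi.neg_apply] at h1
  linarith [h s]

theorem form_comm (x y : S → ℝ) : G.form x y = G.form y x := by
  simp only [form, Matrix.toBilin'_apply]
  rw [Finset.sum_comm]
  refine Finset.sum_congr rfl fun i _ => Finset.sum_congr rfl fun j _ => ?_
  rw [G.matrixB_symm j i]
  ring

theorem form_rep_rep (w : W) (x y : S → ℝ) : G.form (G.rep w x) (G.rep w y) = G.form x y := by
  induction w using G.cs.simple_induction_left generalizing x y with
  | one => simp
  | mul_simple_left w s ih =>
    rw [rep_mul_apply, rep_mul_apply, rep_simple, simpleReflection_apply, simpleReflection_apply,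
      ← ih x y]
    simp only [map_sub, map_smul, LinearMap.sub_apply, LinearMap.smul_apply, smul_eq_mul,
      form_simpleRoot_self, G.form_comm (G.simpleRoot s)]
    ring

theorem rep_rep_inv (w : W) (x : S → ℝ) : G.rep w (G.rep w⁻¹ x) = x := by
  rw [← rep_mul_apply, mul_inv_cancel, map_one, LinearEquiv.coe_one, id]

theorem form_rep_inv (w : W) (x y : S → ℝ) : G.form x (G.rep w⁻¹ y) = G.form (G.rep w x) y := by
  rw [← G.form_rep_rep w, rep_rep_inv]

theorem tendsto_form {ι : Type*} {l : Filter ι} {x y : ι → S → ℝ} {a b : S → ℝ}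
    (hx : Tendsto x l (𝓝 a)) (hy : Tendsto y l (𝓝 b)) :
    Tendsto (fun k => G.form (x k) (y k)) l (𝓝 (G.form a b)) := by
  simp only [form, Matrix.toBilin'_apply]
  exact tendsto_finsetSum _ fun i _ => tendsto_finsetSum _ fun j _ =>
    ((hx.apply_nhds i).mul tendsto_const_nhds).mul (hy.apply_nhds j)

theorem rep_apply_eq_sum (w : W) (x : S → ℝ) :
    G.rep w x = ∑ s, x s • G.rep w (G.simpleRoot s) := by
  conv_lhs => rw [pi_eq_sum_univ' x]
  simp [map_sum, simpleRoot]

/-! ### Linear algebra of Lorentzian forms -/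

section Lorentzian

variable {G} (hG : G.IsLorentzian)
include hG

theorem IsLorentzian.eq_zero_of_form_eq_zero {x : S → ℝ} (hx : ∀ y, G.form x y = 0) : x = 0 := by
  have h := QuadraticForm.sigPos_add_sigNeg_add_radical
    (Q := LinearMap.BilinMap.toQuadraticMap G.form)
  rw [hG.2, hG.1, Module.finrank_fintype_fun_eq_card] at h
  have h0 : (LinearMap.BilinMap.toQuadraticMap G.form).radical = ⊥ :=
    Submodule.finrank_eq_zero.1 (by omega)
  rw [← Submodule.mem_bot ℝ, ← h0, QuadraticMap.mem_radical_iff']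
  refine ⟨hx x, fun n => ?_⟩
  simp [hx, G.form_comm n x]

theorem IsLorentzian.exists_form_eq (φ : (S → ℝ) →ₗ[ℝ] ℝ) : ∃ q, ∀ v, G.form q v = φ v := by
  have hinj : Function.Injective G.form :=
    (injective_iff_map_eq_zero _).2 fun x hx => hG.eq_zero_of_form_eq_zero fun y => by simp [hx]
  have hsurj := (LinearMap.injective_iff_surjective_of_finrank_eq_finrank
    (f := G.form) (Subspace.dual_finrank_eq (K := ℝ) (V := S → ℝ)).symm).1 hinj
  obtain ⟨q, hq⟩ := hsurj φ
  exact ⟨q, fun v => by rw [hq]⟩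

/-- Orthogonal isotropic vectors of a Lorentzian form are proportional. -/
theorem IsLorentzian.exists_smul_eq {u x : S → ℝ} (hu0 : u ≠ 0) (hu : G.form u u = 0)
    (hx : G.form x x = 0) (hux : G.form u x = 0) : ∃ c : ℝ, c • u = x := by
  by_contra! hcon
  have hli := (LinearIndependent.pair_iff' hu0).2 hcon
  -- Otherwise `u` and `x` span a totally isotropic plane, too large next to a positive part of
  -- dimension `n - 1`.
  have h := QuadraticForm.sigPos_add_finrank_le_of_nonpos
    (Q := LinearMap.BilinMap.toQuadraticMap G.form) (V := Submodule.span ℝ (Set.range ![u, x])) (by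
      intro y hy
      rw [Matrix.range_cons_cons_empty, Submodule.mem_span_pair] at hy
      obtain ⟨a, b, rfl⟩ := hy
      simp [hu, hx, hux, G.form_comm x u])
  rw [finrank_span_eq_card hli, Module.finrank_fintype_fun_eq_card, ← hG.1] at h
  simp at h

theorem IsLorentzian.exists_isotropic : ∃ v : S → ℝ, v ≠ 0 ∧ G.form v v = 0 := by
  obtain ⟨N, hN, hneg⟩ :=
    exists_finrank_eq_sigNeg_and_negDef (LinearMap.BilinMap.toQuadraticMap G.form)
  rw [hG.2] at hN
  obtain ⟨e, he0⟩ : ∃ e : N, e ≠ 0 :=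
    have := Module.nontrivial_of_finrank_pos (R := ℝ) (M := N) (by omega)
    exists_ne 0
  have he : G.form e e < 0 := by simpa using hneg e he0
  have hS : Nonempty S := by
    rw [← Fintype.card_pos_iff, ← hG.1]
    omega
  obtain ⟨s⟩ := hS
  set b := G.form (G.simpleRoot s) e
  have hd : 0 ≤ b ^ 2 - G.form e e := by nlinarith [sq_nonneg b]
  -- A root of the quadratic `B(α_s + t e, α_s + t e)`, with `B(α_s, α_s) = 1` and `B(e, e) < 0`.
  set t : ℝ := (-b + √(b ^ 2 - G.form e e)) / G.form e e
  have ht : G.form e e * t ^ 2 + 2 * b * t + 1 = 0 := by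
    have := Real.sq_sqrt hd
    have hne := he.ne
    simp only [t]
    field_simp
    linear_combination this
  refine ⟨G.simpleRoot s + t • (e : S → ℝ), fun h0 => ?_, ?_⟩
  · have h1 : G.simpleRoot s = -(t • (e : S → ℝ)) := eq_neg_of_add_eq_zero_left h0
    have h2 := G.form_simpleRoot_self s
    rw [h1] at h2
    simp only [map_neg, map_smul, LinearMap.neg_apply, LinearMap.smul_apply, smul_eq_mul] at h2
    nlinarith [sq_nonneg t]
  · simp only [map_add, map_smul, LinearMap.add_apply, LinearMap.smul_apply, smul_eq_mul,
      form_simpleRoot_self, G.form_comm (e : S → ℝ) (G.simpleRoot s)]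
    linear_combination ht

theorem IsLorentzian.exists_form_simpleRoot_ne_zero {q : S → ℝ} (hq : q ≠ 0) :
    ∃ s, G.form q (G.simpleRoot s) ≠ 0 := by
  by_contra! h
  refine hq (hG.eq_zero_of_form_eq_zero fun y => ?_)
  rw [pi_eq_sum_univ' y, map_sum]
  refine Finset.sum_eq_zero fun s _ => ?_
  rw [map_smul]
  have := h s
  simp only [simpleRoot] at this
  simp [this]

/-- Weak convergence with respect to a Lorentzian form is convergence. -/
theorem IsLorentzian.tendsto_of_tendsto_form {ι : Type*} {l : Filter ι} {y : ι → S → ℝ}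
    {b : S → ℝ} (h : ∀ x, Tendsto (fun k => G.form x (y k)) l (𝓝 (G.form x b))) :
    Tendsto y l (𝓝 b) := by
  rw [tendsto_pi_nhds]
  intro s
  obtain ⟨q, hq⟩ := hG.exists_form_eq (LinearMap.proj s)
  simpa [hq] using h q

/-! ### Discreteness and rank-one limits -/

/-- The image of `W` in `GL(V)` is discrete, with finite intersections with bounded sets. -/
theorem IsLorentzian.finite_norm_rep_le (R : ℝ) :
    {w : W | ‖fun s => G.rep w (G.simpleRoot s)‖ ≤ R}.Finite := by
  by_contra hinf
  let w : ℕ → W := fun k => (Set.Infinite.natEmbedding _ hinf k : W)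
  have hwinj : Function.Injective w :=
    Subtype.val_injective.comp (Set.Infinite.natEmbedding _ hinf).injective
  obtain ⟨A, -, φ, hφ, hA⟩ := (isCompact_closedBall (0 : S → S → ℝ) R).tendsto_subseq
    (x := fun k s => G.rep (w k) (G.simpleRoot s))
    (fun k => by
      rw [mem_closedBall_zero_iff]
      exact (Set.Infinite.natEmbedding _ hinf k).2)
  have hAx : ∀ x : S → ℝ, Tendsto (fun k => G.rep (w (φ k)) x) atTop (𝓝 (∑ s, x s • A s)) := by
    intro x
    simp_rw [G.rep_apply_eq_sum _ x]
    exact tendsto_finsetSum _ fun s _ => (hA.apply_nhds s).const_smul _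
  have hAiso : ∀ x y : S → ℝ, G.form (∑ s, x s • A s) (∑ s, y s • A s) = G.form x y :=
    fun x y => tendsto_nhds_unique (G.tendsto_form (hAx x) (hAx y))
      (by simp [form_rep_rep])
  -- Consecutive quotients tend to the identity. Moving the inverse across the form makes this
  -- follow from `A` being an isometry, without inverting `A`.
  have hlim : ∀ s, Tendsto (fun k => G.rep ((w (φ k))⁻¹ * w (φ (k + 1))) (G.simpleRoot s)) atTop
      (𝓝 (G.simpleRoot s)) := by
    intro s
    refine hG.tendsto_of_tendsto_form fun x => ?_
    simp_rw [rep_mul_apply, form_rep_inv]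
    rw [← hAiso]
    exact G.tendsto_form (hAx x) ((tendsto_add_atTop_iff_nat 1).2 (hAx (G.simpleRoot s)))
  have hev : ∀ᶠ k in atTop, ∀ s,
      0 < G.rep ((w (φ k))⁻¹ * w (φ (k + 1))) (G.simpleRoot s) s :=
    eventually_all.2 fun s => ((hlim s).apply_nhds s).eventually_const_lt (by simp [simpleRoot])
  obtain ⟨k, hk⟩ := hev.exists
  have := G.eq_one_of_rep_simpleRoot_pos _ hk
  rw [inv_mul_eq_one] at this
  have := hφ.injective (hwinj this)
  omega

/-- A sequence of distinct elements of `W` has a subsequence that, after rescaling, converges to a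
map of rank one with isotropic kernel and image directions. -/
theorem IsLorentzian.exists_subseq_tendsto {w : ℕ → W} (hw : Function.Injective w) :
    ∃ (φ : ℕ → ℕ) (N : ℕ → ℝ) (u q : S → ℝ), StrictMono φ ∧ Tendsto N atTop atTop ∧
      u ≠ 0 ∧ q ≠ 0 ∧ G.form u u = 0 ∧ G.form q q = 0 ∧
      (∀ v, Tendsto (fun k => (N k)⁻¹ • G.rep (w (φ k)) v) atTop (𝓝 (G.form q v • u))) ∧
      ∀ v, Tendsto (fun k => (N k)⁻¹ • G.rep (w (φ k))⁻¹ v) atTop (𝓝 (G.form u v • q)) := by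
  let F : ℕ → S → S → ℝ := fun k s => G.rep (w k) (G.simpleRoot s)
  have hF : Tendsto (fun k => ‖F k‖) atTop atTop := by
    rw [tendsto_atTop]
    intro R
    rw [← Nat.cofinite_eq_atTop, Filter.eventually_cofinite]
    refine ((hG.finite_norm_rep_le R).preimage hw.injOn).subset fun k hk => ?_
    exact (not_le.1 hk).le
  obtain ⟨A, -, φ, hφ, hA⟩ := (isCompact_closedBall (0 : S → S → ℝ) 1).tendsto_subseq
    (x := fun k => ‖F k‖⁻¹ • F k)
    (fun k => by
      rw [mem_closedBall_zero_iff, norm_smul, norm_inv, norm_norm]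
      exact inv_mul_le_one)
  have hN : Tendsto (fun k => ‖F (φ k)‖) atTop atTop := hF.comp hφ.tendsto_atTop
  have hNinv : Tendsto (fun k => ‖F (φ k)‖⁻¹) atTop (𝓝 0) := tendsto_inv_atTop_zero.comp hN
  have hA0 : A ≠ 0 := by
    have h1 : Tendsto (fun k => ‖‖F (φ k)‖⁻¹ • F (φ k)‖) atTop (𝓝 1) := by
      refine tendsto_const_nhds.congr' ?_
      filter_upwards [hN.eventually_gt_atTop 0] with k hk
      rw [norm_smul, norm_inv, norm_norm, inv_mul_cancel₀ hk.ne']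
    have h2 := tendsto_nhds_unique hA.norm h1
    rintro rfl
    simp at h2
  let L : (S → ℝ) →ₗ[ℝ] (S → ℝ) := ∑ s, (LinearMap.proj s).smulRight (A s)
  have hL : ∀ v, L v = ∑ s, v s • A s := fun v => by simp [L]
  have hLv : ∀ v, Tendsto (fun k => ‖F (φ k)‖⁻¹ • G.rep (w (φ k)) v) atTop (𝓝 (L v)) := by
    intro v
    rw [hL]
    simp_rw [G.rep_apply_eq_sum _ v, Finset.smul_sum, smul_comm _ (v _)]
    exact tendsto_finsetSum _ fun s _ => (hA.apply_nhds s).const_smul _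
  have hiso : ∀ x y, G.form (L x) (L y) = 0 := by
    intro x y
    refine tendsto_nhds_unique (G.tendsto_form (hLv x) (hLv y)) ?_
    simp only [map_smul, LinearMap.smul_apply, form_rep_rep, smul_eq_mul]
    simpa using hNinv.mul (hNinv.mul_const (G.form x y))
  obtain ⟨s, hs⟩ : ∃ s, A s ≠ 0 := Function.ne_iff.1 hA0
  have hLs : L (G.simpleRoot s) = A s := by
    rw [hL]
    simp [simpleRoot, Pi.single_apply]
  have hu : G.form (A s) (A s) = 0 := by rw [← hLs]; exact hiso _ _
  obtain ⟨i, hi⟩ : ∃ i, A s i ≠ 0 := Function.ne_iff.1 hs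
  -- The values of `L` are multiples of `A s`; the multiple is read off at a coordinate `i` where `A
  -- s` does not vanish.
  obtain ⟨q, hq⟩ := hG.exists_form_eq ((A s i)⁻¹ • (LinearMap.proj i).comp L)
  have hLq : ∀ v, L v = G.form q v • A s := by
    intro v
    obtain ⟨c, hc⟩ := hG.exists_smul_eq hs hu (hiso v v) (by rw [← hLs]; exact hiso _ _)
    rw [hq]
    simp [← hc, mul_comm c, hi]
  have hq0 : q ≠ 0 := by
    rintro rfl
    apply hs
    rw [← hLs, hLq]
    simp
  have hinv : ∀ v, Tendsto (fun k => ‖F (φ k)‖⁻¹ • G.rep (w (φ k))⁻¹ v) atTop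
      (𝓝 (G.form (A s) v • q)) := by
    intro v
    refine hG.tendsto_of_tendsto_form fun x => ?_
    have h1 := G.tendsto_form (hLv x) (tendsto_const_nhds (x := v))
    rw [hLq] at h1
    simp only [map_smul, LinearMap.smul_apply, form_rep_inv, smul_eq_mul] at h1 ⊢
    rwa [mul_comm, G.form_comm x q]
  refine ⟨φ, fun k => ‖F (φ k)‖, A s, q, hφ, hN, hs, hq0, hu, ?_, fun v => ?_, hinv⟩
  · obtain ⟨t, ht⟩ := hG.exists_form_simpleRoot_ne_zero hs
    have h1 := G.tendsto_form (hinv (G.simpleRoot t)) (hinv (G.simpleRoot t))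
    simp only [map_smul, LinearMap.smul_apply, form_rep_rep, smul_eq_mul] at h1
    have h2 := tendsto_nhds_unique h1
      (by simpa using hNinv.mul (hNinv.mul_const (G.form (G.simpleRoot t) (G.simpleRoot t))))
    simpa [ht] using h2
  · rw [← hLq]
    exact hLv v

end Lorentzian

end GeometricCoxeterSystem

/-! ### Convergence in projective space through representatives -/

namespace Projectivization

variable {S : Type*} [Fintype S]

theorem exists_tendsto_smul_of_tendsto_mk {ι : Type*} {l : Filter ι} {v : ι → S → ℝ}
    (hv : ∀ k, v k ≠ 0) {a : S → ℝ} (ha : a ≠ 0)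
    (h : Tendsto (fun k => mk ℝ (v k) (hv k)) l (𝓝 (mk ℝ a ha))) :
    ∃ c : ι → ℝ, Tendsto (fun k => c k • v k) l (𝓝 a) := by
  -- The orthogonal projection of `a` onto a line depends continuously on the line, and is `a` on
  -- the line of `a`.
  let f : ℙ ℝ (S → ℝ) → S → ℝ :=
    Projectivization.lift (fun v : {v : S → ℝ // v ≠ 0} => ((v.1 ⬝ᵥ a) / (v.1 ⬝ᵥ v.1)) • v.1) (by
      rintro ⟨x, hx⟩ ⟨y, hy⟩ t rfl
      have ht : t ≠ 0 := by rintro rfl; simp at hx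
      have hyy : y ⬝ᵥ y ≠ 0 := by rwa [Ne, dotProduct_self_eq_zero]
      simp only [smul_dotProduct, dotProduct_smul, smul_eq_mul, smul_smul]
      congr 1
      field_simp)
  have hf : Continuous f := by
    refine continuous_coinduced_dom.2 ?_
    have : Continuous fun v : {v : S → ℝ // v ≠ 0} => ((v.1 ⬝ᵥ a) / (v.1 ⬝ᵥ v.1)) • v.1 := by
      have hval : Continuous fun v : {v : S → ℝ // v ≠ 0} => v.1 := continuous_subtype_val
      have hne : ∀ v : {v : S → ℝ // v ≠ 0}, v.1 ⬝ᵥ v.1 ≠ 0 := fun v => by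
        rw [Ne, dotProduct_self_eq_zero]
        exact v.2
      exact ((hval.dotProduct continuous_const).div (hval.dotProduct hval) hne).smul hval
    exact this
  refine ⟨fun k => (v k ⬝ᵥ a) / (v k ⬝ᵥ v k), ?_⟩
  have h1 := (hf.tendsto _).comp h
  have h2 : f (mk ℝ a ha) = a := by
    have haa : a ⬝ᵥ a ≠ 0 := by rwa [Ne, dotProduct_self_eq_zero]
    change ((a ⬝ᵥ a) / (a ⬝ᵥ a)) • a = a
    rw [div_self haa, one_smul]
  rwa [h2] at h1

theorem tendsto_mk_of_tendsto_smul {ι : Type*} {l : Filter ι} {v : ι → S → ℝ}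
    (hv : ∀ k, v k ≠ 0) {a : S → ℝ} (ha : a ≠ 0) {c : ι → ℝ}
    (h : Tendsto (fun k => c k • v k) l (𝓝 a)) :
    Tendsto (fun k => mk ℝ (v k) (hv k)) l (𝓝 (mk ℝ a ha)) := by
  classical
  let g : ι → {v : S → ℝ // v ≠ 0} := fun k =>
    if hk : c k • v k ≠ 0 then ⟨c k • v k, hk⟩ else ⟨a, ha⟩
  have hne : ∀ᶠ k in l, c k • v k ≠ 0 := h.eventually_ne ha
  have hg : Tendsto g l (𝓝 ⟨a, ha⟩) := by
    rw [tendsto_subtype_rng]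
    refine h.congr' ?_
    filter_upwards [hne] with k hk
    simp only [g, dif_pos hk]
  have hmk : Continuous (Projectivization.mk' ℝ : {v : S → ℝ // v ≠ 0} → ℙ ℝ (S → ℝ)) :=
    continuous_coinduced_rng
  refine ((hmk.tendsto ⟨a, ha⟩).comp hg).congr' ?_
  filter_upwards [hne] with k hk
  simp only [Function.comp, g, dif_pos hk, mk'_eq_mk]
  exact (mk_eq_mk_iff' ℝ _ _ _ _).2 ⟨c k, rfl⟩

end Projectivization

theorem tendsto_norm_atTop_of_tendsto_inv_smul {ι E : Type*} [NormedAddCommGroup E]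
    [NormedSpace ℝ E] {l : Filter ι} {N : ι → ℝ} (hN : Tendsto N l atTop) {y : ι → E} {b : E}
    (hb : b ≠ 0) (h : Tendsto (fun k => (N k)⁻¹ • y k) l (𝓝 b)) :
    Tendsto (fun k => ‖y k‖) l atTop := by
  refine (hN.atTop_mul_pos (norm_pos_iff.2 hb) h.norm).congr' ?_
  filter_upwards [hN.eventually_gt_atTop 0] with k hk
  rw [norm_smul, norm_inv, Real.norm_of_nonneg hk.le, mul_inv_cancel_left₀ hk.ne']

/-! ### Limit directions and limit roots -/

namespace GeometricCoxeterSystem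

variable {S W : Type*} [Group W] [Fintype S] [DecidableEq S] (G : GeometricCoxeterSystem S W)

theorem rep_mem_roots (w : W) (s : S) : G.rep w (G.simpleRoot s) ∈ G.roots := ⟨w, s, rfl⟩

/-- The directions of an unbounded sequence of roots converge to limit roots only. -/
theorem mk_mem_limitRoots {γ : ℕ → S → ℝ} (hγ : ∀ k, γ k ∈ G.roots)
    (hnorm : Tendsto (fun k => ‖γ k‖) atTop atTop) {c : ℕ → ℝ} {a : S → ℝ} (ha : a ≠ 0)
    (h : Tendsto (fun k => c k • γ k) atTop (𝓝 a)) :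
    Projectivization.mk ℝ a ha ∈ G.limitRoots := by
  obtain ⟨φ, hφ, hmono⟩ := strictMono_subseq_of_tendsto_atTop hnorm
  refine ⟨γ ∘ φ, fun k => hγ _, fun i j hij => hmono.injective (congrArg norm hij), ?_⟩
  exact Projectivization.tendsto_mk_of_tendsto_smul _ ha (h.comp hφ.tendsto_atTop)

theorem mk_mem_projLightCone_iff {v : S → ℝ} (hv : v ≠ 0) :
    Projectivization.mk ℝ v hv ∈ G.projLightCone ↔ G.form v v = 0 := by
  constructor
  · rintro ⟨u, hu0, hu, h⟩
    obtain ⟨c, rfl⟩ := (Projectivization.mk_eq_mk_iff' ℝ _ _ _ _).1 h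
    simp [hu]
  · exact fun h => ⟨v, hv, h, rfl⟩

theorem injective_of_arisesThrough {G : GeometricCoxeterSystem S W} {w : ℕ → W}
    {x₀ x : ℙ ℝ (S → ℝ)} (h : G.ArisesThrough w x₀ x) : Function.Injective w :=
  fun i j hij => h.1 (by simp only [hij])

theorem exists_tendsto_smul_of_arisesThrough {G : GeometricCoxeterSystem S W} {w : ℕ → W}
    {v a : S → ℝ} {hv : v ≠ 0} {ha : a ≠ 0}
    (h : G.ArisesThrough w (Projectivization.mk ℝ v hv) (Projectivization.mk ℝ a ha)) :
    ∃ c : ℕ → ℝ, Tendsto (fun k => c k • G.rep (w k) v) atTop (𝓝 a) :=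
  Projectivization.exists_tendsto_smul_of_tendsto_mk
    (fun k => (G.rep (w k)).map_ne_zero_iff.2 hv) ha h.2

theorem mem_projLightCone_of_arisesThrough {w : ℕ → W} {x₀ x : ℙ ℝ (S → ℝ)}
    (hx₀ : x₀ ∈ G.projLightCone) (h : G.ArisesThrough w x₀ x) : x ∈ G.projLightCone := by
  induction x using Projectivization.ind with | _ a ha =>
  obtain ⟨v, hv, hvv, rfl⟩ := hx₀
  obtain ⟨c, hc⟩ := exists_tendsto_smul_of_arisesThrough h
  rw [mk_mem_projLightCone_iff]
  refine tendsto_nhds_unique (G.tendsto_form hc hc) ?_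
  simp [form_rep_rep, hvv]

section Lorentzian

variable {G} (hG : G.IsLorentzian)
include hG

/-- A sequence that contracts towards the isotropic direction `u` away from `q` sends every point
other than `q` either to `u` or to no isotropic direction. -/
theorem IsLorentzian.eq_mk_of_arisesThrough {w : ℕ → W} {φ : ℕ → ℕ} (hφ : StrictMono φ)
    {N : ℕ → ℝ} (hN : Tendsto N atTop atTop) {u q : S → ℝ} (hu0 : u ≠ 0) (hq0 : q ≠ 0)
    (hu : G.form u u = 0) (hq : G.form q q = 0)
    (hlim : ∀ v, Tendsto (fun k => (N k)⁻¹ • G.rep (w (φ k)) v) atTop (𝓝 (G.form q v • u)))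
    {x₀ x : ℙ ℝ (S → ℝ)} (hx₀ : x₀ ≠ Projectivization.mk ℝ q hq0) (h : G.ArisesThrough w x₀ x)
    (hx : x ∈ G.projLightCone) : x = Projectivization.mk ℝ u hu0 := by
  induction x₀ using Projectivization.ind with | _ v hv =>
  obtain ⟨a, ha, haa, rfl⟩ := hx
  obtain ⟨c, hc⟩ := exists_tendsto_smul_of_arisesThrough h
  replace hc := hc.comp hφ.tendsto_atTop
  -- If `v` is isotropic, `w v` is unbounded because `B(q, v) ≠ 0`; otherwise `c ^ 2 * B(v, v) →
  -- B(a, a) = 0`.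
  have hc0 : Tendsto (fun k => c (φ k)) atTop (𝓝 0) := by
    by_cases hvv : G.form v v = 0
    · have hqv : G.form q v ≠ 0 := by
        intro hqv
        apply hx₀
        obtain ⟨t, ht⟩ := hG.exists_smul_eq hq0 hq hvv hqv
        exact (Projectivization.mk_eq_mk_iff' ℝ _ _ _ _).2 ⟨t, ht⟩
      have h1 := tendsto_norm_atTop_of_tendsto_inv_smul hN (smul_ne_zero hqv hu0) (hlim v)
      rw [tendsto_zero_iff_norm_tendsto_zero]
      refine (hc.norm.div_atTop h1).congr' ?_
      filter_upwards [h1.eventually_gt_atTop 0] with k hk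
      simp only [Function.comp, norm_smul]
      exact mul_div_cancel_right₀ _ hk.ne'
    · have h1 := G.tendsto_form hc hc
      simp only [Function.comp, map_smul, LinearMap.smul_apply, form_rep_rep, smul_eq_mul,
        haa] at h1
      have h2 : Tendsto (fun k => c (φ k) ^ 2) atTop (𝓝 0) := by
        have := h1.mul_const (G.form v v)⁻¹
        simp only [zero_mul] at this
        refine this.congr fun k => ?_
        field_simp
      rw [tendsto_zero_iff_abs_tendsto_zero]
      simpa [Function.comp_def, Real.sqrt_sq_eq_abs] using h2.sqrt
  obtain ⟨s, hs⟩ := hG.exists_form_simpleRoot_ne_zero hq0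
  -- By invariance the pairing is `N⁻¹ c B(α_s, v) → 0`, while its limit is `B(q, α_s) B(u, a)`.
  have h1 := G.tendsto_form (hlim (G.simpleRoot s)) hc
  simp only [Function.comp, map_smul, LinearMap.smul_apply, form_rep_rep, smul_eq_mul] at h1
  have h2 := tendsto_nhds_unique h1 (by
    simpa using hc0.mul ((tendsto_inv_atTop_zero.comp hN).mul_const (G.form (G.simpleRoot s) v)))
  have hua : G.form u a = 0 := by simpa [hs] using h2
  obtain ⟨t, ht⟩ := hG.exists_smul_eq hu0 hu haa hua
  exact (Projectivization.mk_eq_mk_iff' ℝ _ _ _ _).2 ⟨t, ht⟩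

theorem IsLorentzian.mem_limitRoots_of_arisesThrough {w : ℕ → W} {x₀ x : ℙ ℝ (S → ℝ)}
    (h : G.ArisesThrough w x₀ x) (hx : x ∈ G.projLightCone) : x ∈ G.limitRoots := by
  obtain ⟨φ, N, u, q, hφ, hN, hu0, hq0, hu, hq, hlim, hinv⟩ :=
    hG.exists_subseq_tendsto (injective_of_arisesThrough h)
  by_cases hx₀ : x₀ = Projectivization.mk ℝ q hq0
  · subst hx₀
    obtain ⟨a, ha, haa, rfl⟩ := hx
    obtain ⟨c, hc⟩ := exists_tendsto_smul_of_arisesThrough h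
    obtain ⟨s, hs⟩ := hG.exists_form_simpleRoot_ne_zero hu0
    set b := G.form u (G.simpleRoot s)
    -- For fixed `k`, the roots `w k (w (φ j))⁻¹ α_s`, rescaled, tend to `c k • w k q` as `j → ∞`.
    -- The lower bound `k` on the norm keeps the diagonal sequence of roots unbounded.
    have hchoice : ∀ k : ℕ, ∃ j, (k : ℝ) ≤ ‖G.rep (w k * (w (φ j))⁻¹) (G.simpleRoot s)‖ ∧
        dist ((c k * b⁻¹ * (N j)⁻¹) • G.rep (w k * (w (φ j))⁻¹) (G.simpleRoot s))
          (c k • G.rep (w k) q) < 1 / ((k : ℝ) + 1) := by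
      intro k
      have h1 : Tendsto (fun j => (N j)⁻¹ • G.rep (w k * (w (φ j))⁻¹) (G.simpleRoot s)) atTop
          (𝓝 (b • G.rep (w k) q)) := by
        have hcont : Continuous (G.rep (w k)) :=
          LinearMap.continuous_of_finiteDimensional (G.rep (w k)).toLinearMap
        have := (hcont.tendsto _).comp (hinv (G.simpleRoot s))
        simpa [Function.comp_def, rep_mul_apply] using this
      have h2 := tendsto_norm_atTop_of_tendsto_inv_smul hN
        (smul_ne_zero hs ((G.rep (w k)).map_ne_zero_iff.2 hq0)) h1
      have h3 := h1.const_smul (c k * b⁻¹)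
      rw [smul_smul, inv_mul_cancel_right₀ hs] at h3
      simp_rw [smul_smul] at h3
      exact ((h2.eventually_ge_atTop _).and
        (Metric.tendsto_nhds.1 h3 _ (by positivity))).exists
    choose j hj1 hj2 using hchoice
    refine G.mk_mem_limitRoots (γ := fun k => G.rep (w k * (w (φ (j k)))⁻¹) (G.simpleRoot s))
      (fun k => G.rep_mem_roots _ _) (tendsto_atTop_mono hj1 tendsto_natCast_atTop_atTop)
      (c := fun k => c k * b⁻¹ * (N (j k))⁻¹) ha ?_
    refine hc.congr_dist (squeeze_zero (fun _ => dist_nonneg) (fun k => ?_)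
      tendsto_one_div_add_atTop_nhds_zero_nat)
    rw [dist_comm]
    exact (hj2 k).le
  · rw [hG.eq_mk_of_arisesThrough hφ hN hu0 hq0 hu hq hlim hx₀ h hx]
    obtain ⟨s, hs⟩ := hG.exists_form_simpleRoot_ne_zero hq0
    have hne := smul_ne_zero hs hu0
    have := G.mk_mem_limitRoots (fun k => G.rep_mem_roots (w (φ k)) s)
      (tendsto_norm_atTop_of_tendsto_inv_smul hN hne (hlim _)) hne (hlim (G.simpleRoot s))
    rwa [(Projectivization.mk_eq_mk_iff' ℝ _ u hne hu0).2 ⟨_, rfl⟩] at this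

theorem IsLorentzian.exists_forall_arisesThrough_eq (w : ℕ → W) :
    ∃ p ∈ G.projLightCone, ∀ x₀ y₀ x y : ℙ ℝ (S → ℝ), x₀ ≠ p → y₀ ≠ p →
      G.ArisesThrough w x₀ x → x ∈ G.projLightCone →
      G.ArisesThrough w y₀ y → y ∈ G.projLightCone → x = y := by
  by_cases hw : Function.Injective w
  · obtain ⟨φ, N, u, q, hφ, hN, hu0, hq0, hu, hq, hlim, -⟩ := hG.exists_subseq_tendsto hw
    refine ⟨Projectivization.mk ℝ q hq0, ⟨q, hq0, hq, rfl⟩,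
      fun x₀ y₀ x y hx₀ hy₀ hx hxQ hy hyQ => ?_⟩
    rw [hG.eq_mk_of_arisesThrough hφ hN hu0 hq0 hu hq hlim hx₀ hx hxQ,
      hG.eq_mk_of_arisesThrough hφ hN hu0 hq0 hu hq hlim hy₀ hy hyQ]
  -- No limit direction arises through a non-injective sequence, so any light-like point serves as
  -- `p`.
  · obtain ⟨v, hv, hvv⟩ := hG.exists_isotropic
    exact ⟨Projectivization.mk ℝ v hv, ⟨v, hv, hvv, rfl⟩,
      fun _ _ _ _ _ _ hx => absurd (injective_of_arisesThrough hx) hw⟩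

end Lorentzian

end GeometricCoxeterSystem

theorem mainTheorem3 {S W : Type*} [Fintype S] [DecidableEq S] [Group W]
    (G : GeometricCoxeterSystem S W) (hG : G.IsLorentzian) :
    -- a limit direction on the projective light cone, from any base point, is a limit root
    (∀ (w : ℕ → W) (x₀ x : ℙ ℝ (S → ℝ)),
      G.ArisesThrough w x₀ x → x ∈ G.projLightCone → x ∈ G.limitRoots) ∧
    -- every limit direction arising from a light-like base point is a limit root
    (∀ (w : ℕ → W) (x₀ x : ℙ ℝ (S → ℝ)),
      x₀ ∈ G.projLightCone → G.ArisesThrough w x₀ x → x ∈ G.limitRoots) ∧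
    -- light-like limits arising through the same sequence coincide, for all base points other
    -- than at most one light-like direction depending on the sequence
    (∀ w : ℕ → W, ∃ p ∈ G.projLightCone, ∀ x₀ y₀ x y : ℙ ℝ (S → ℝ),
      x₀ ≠ p → y₀ ≠ p →
      G.ArisesThrough w x₀ x → x ∈ G.projLightCone →
      G.ArisesThrough w y₀ y → y ∈ G.projLightCone → x = y) := by
  exact ⟨fun _ _ _ h hx => hG.mem_limitRoots_of_arisesThrough h hx,
    fun _ _ _ hx₀ h => hG.mem_limitRoots_of_arisesThrough h
      (G.mem_projLightCone_of_arisesThrough hx₀ h),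
    hG.exists_forall_arisesThrough_eq⟩
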